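/- Let $\mathsf{Cnf}$ be the set of Cantor normal forms: the unlabelled binary trees generated by $0$ and $(a,b)\mapsto\omega^a+b$ in which every subtree $\omega^s+t$ satisfies $\mathrm{left}(t)\le s$ (where $\mathrm{left}(0)=0$, $\mathrm{left}(\omega^a+b)=a$), ordered by the hereditary lexicographic order $<$ with reflexive closure $\le$. Let $\mathsf{Brw}$ be the type of Brouwer trees: the quotient inductive-inductive type with constructors $\mathsf{zero}$, $\mathsf{succ}$, $\mathsf{limit}\,f$ for every sequence $f:\mathbb N\to\mathsf{Brw}$ with $f_k<f_{k+1}$ for all $k$, and an identification $\mathsf{limit}\,f=\mathsf{limit}\,g$ whenever $\forall k\,\exists n\; f_k\le g_n$ and $\forall k\,\exists n\; g_k\le f_n$; here $x<y$ means $\mathsf{succ}\,x\le y$, and the relation $\le$ is generated simultaneously by: $\mathsf{zero}\le x$; transitivity; $x\le y\Rightarrow\mathsf{succ}\,x\le\mathsf{succ}\,y$; $x\le f_k\Rightarrow x\le\mathsf{limit}\,f$; $(\forall k\; f_k\le x)\Rightarrow\mathsf{limit}\,f\le x$. Addition and the powers $\omega^{y}$ on $\mathsf{Brw}$ are given by the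 usual recursion on $y$, and $\mathsf{CtoB}:\mathsf{Cnf}\to\mathsf{Brw}$ by $\mathsf{CtoB}(0)=\mathsf{zero}$, $\mathsf{CtoB}(\omega^a+b)=\omega^{\mathsf{CtoB}(a)}+\mathsf{CtoB}(b)$. Say that $\mathsf{CtoB}$ preserves limits of strictly increasing sequences if, for every strictly increasing $f:\mathbb N\to\mathsf{Cnf}$ and every $x\in\mathsf{Cnf}$ that is the least upper bound of $f$ in $\mathsf{Cnf}$, the sequence $\mathsf{CtoB}\circ f$ is strictly increasing and $\mathsf{CtoB}(x)=\mathsf{limit}(\mathsf{CtoB}\circ f)$. Markov's principle $\mathsf{MP}$ says that every $s:\mathbb N\to\{\mathsf{ff},\mathsf{tt}\}$ with $\neg\forall n\,(s_n=\mathsf{ff})$ satisfies $\exists n\,(s_n=\mathsf{tt})$. Theorem. $\mathsf{CtoB}$ preserves limits of strictly increasing sequences if and only if $\mathsf{MP}$ holds. The equivalence holds without excluded middle: besides holding for ordinary sets, it holds in the Heyting-valued sets (sheaves) over every complete Heyting algebra $H$. That is, if all the notions above are interpreted there, then the truth value in $H$ of "$\mathsf{CtoB}$ preserves limits of strictly increasing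 sequences" equals the truth value in $H$ of $\mathsf{MP}$. -/

import Mathlib

/-! ### Cantor normal forms -/

/-- Unlabelled binary trees; `node a b` stands for `ω ^ a + b`. -/
inductive CTree : Type
  | zero : CTree
  | node : CTree → CTree → CTree

namespace CTree

/-- The hereditary lexicographical order. -/
inductive Lt : CTree → CTree → Prop
  | zero_node (a b : CTree) : Lt zero (node a b)
  | left {a c : CTree} (b d : CTree) : Lt a c → Lt (node a b) (node c d)
  | right (a : CTree) {b d : CTree} : Lt b d → Lt (node a b) (node a d)

def Le (s t : CTree) : Prop := Lt s t ∨ s = t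

/-- The left subtree. -/
def left : CTree → CTree
  | zero => zero
  | node a _ => a

/-- A tree is a Cantor normal form if exponents are weakly decreasing, hereditarily. -/
inductive IsCNF : CTree → Prop
  | zero : IsCNF zero
  | node {s t : CTree} : IsCNF s → IsCNF t → Le (left t) s → IsCNF (node s t)

end CTree

/-- Cantor normal forms. -/
def Cnf : Type := {t : CTree // t.IsCNF}

instance : LT Cnf := ⟨fun a b => CTree.Lt a.1 b.1⟩
instance : LE Cnf := ⟨fun a b => CTree.Le a.1 b.1⟩

/-! ### Brouwer trees

`Brw` and its order are the quotient inductive-inductive type generated by `zero`, `succ`,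
`limit` (of strictly increasing sequences) and `bisim`.  It is built from raw trees, by
simultaneously generating which raw trees are well formed, the order, and the equality. -/

/-- Raw trees. -/
inductive Raw : Type
  | zero : Raw
  | succ : Raw → Raw
  | limit : (ℕ → Raw) → Raw

namespace Raw

mutual

/-- Well-formed trees: limits are taken of strictly increasing sequences only. -/
inductive Wf : Raw → Prop
  | zero : Wf zero
  | succ {a : Raw} : Wf a → Wf (succ a)
  | limit {f : ℕ → Raw} : (∀ k, Wf (f k)) → (∀ k, Le (succ (f k)) (f (k + 1))) → Wf (limit f)

/-- The order. -/
inductive Le : Raw → Raw → Prop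
  | zero {a : Raw} : Wf a → Le zero a
  | trans {a b c : Raw} : Le a b → Le b c → Le a c
  | succ_mono {a b : Raw} : Le a b → Le (succ a) (succ b)
  | cocone {a : Raw} {f : ℕ → Raw} (k : ℕ) : Wf (limit f) → Le a (f k) → Le a (limit f)
  | limiting {f : ℕ → Raw} {a : Raw} : Wf (limit f) → (∀ k, Le (f k) a) → Le (limit f) a
  | of_eqv {a b : Raw} : Eqv a b → Le a b

/-- The equality: the congruence generated by identifying limits of bisimilar sequences.
The functions `p` and `q` in `bisim` witness that `f` and `g` simulate each other. -/
inductive Eqv : Raw → Raw → Prop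
  | refl {a : Raw} : Wf a → Eqv a a
  | symm {a b : Raw} : Eqv a b → Eqv b a
  | trans {a b c : Raw} : Eqv a b → Eqv b c → Eqv a c
  | succ {a b : Raw} : Eqv a b → Eqv (succ a) (succ b)
  | limit {f g : ℕ → Raw} : Wf (limit f) → Wf (limit g) → (∀ k, Eqv (f k) (g k)) →
      Eqv (limit f) (limit g)
  | bisim {f g : ℕ → Raw} (p q : ℕ → ℕ) : Wf (limit f) → Wf (limit g) →
      (∀ k, Le (f k) (g (p k))) → (∀ k, Le (g k) (f (q k))) → Eqv (limit f) (limit g)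

end

/-- Addition, by recursion on the second argument. -/
def add (a : Raw) : Raw → Raw
  | zero => a
  | succ b => succ (add a b)
  | limit f => limit fun k => add a (f k)

/-- The finite multiple `a · n`. -/
def nmul (a : Raw) : ℕ → Raw
  | 0 => zero
  | n + 1 => add (nmul a n) a

/-- `ω ^ b`, where `ω ^ (b + 1) = ω ^ b · ω` is the limit of the `ω ^ b · n`. -/
def opow : Raw → Raw
  | zero => succ zero
  | succ b => limit fun n => nmul (opow b) n
  | limit f => limit fun k => opow (f k)

theorem Wf.of_succ {a : Raw} : Wf (Raw.succ a) → Wf a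
  | .succ h => h

theorem Wf.of_limit {f : ℕ → Raw} : Wf (Raw.limit f) → ∀ k, Wf (f k)
  | .limit h _ => h

theorem Wf.incr {f : ℕ → Raw} : Wf (Raw.limit f) → ∀ k, Le (Raw.succ (f k)) (f (k + 1))
  | .limit _ h => h

mutual

theorem Le.wf {a b : Raw} : Le a b → Wf a ∧ Wf b
  | .zero h => ⟨.zero, h⟩
  | .trans h₁ h₂ => ⟨h₁.wf.1, h₂.wf.2⟩
  | .succ_mono h => ⟨.succ h.wf.1, .succ h.wf.2⟩
  | .cocone _ h h' => ⟨h'.wf.1, h⟩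
  | .limiting h h' => ⟨h, (h' 0).wf.2⟩
  | .of_eqv h => h.wf

theorem Eqv.wf {a b : Raw} : Eqv a b → Wf a ∧ Wf b
  | .refl h => ⟨h, h⟩
  | .symm h => ⟨h.wf.2, h.wf.1⟩
  | .trans h₁ h₂ => ⟨h₁.wf.1, h₂.wf.2⟩
  | .succ h => ⟨.succ h.wf.1, .succ h.wf.2⟩
  | .limit h h' _ => ⟨h, h'⟩
  | .bisim _ _ h h' _ _ => ⟨h, h'⟩

end

theorem Le.refl {a : Raw} (h : Wf a) : Le a a := .of_eqv (.refl h)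

theorem Le.self_succ : ∀ {a : Raw}, Wf a → Le a (Raw.succ a)
  | .zero, h => .zero (.succ h)
  | .succ _, h => .succ_mono (self_succ h.of_succ)
  | .limit _, h => .limiting h fun k =>
      (self_succ (h.of_limit k)).trans (.succ_mono (.cocone k h (.refl (h.of_limit k))))

theorem Le.self_add {a : Raw} (ha : Wf a) : ∀ {b : Raw}, Wf (add a b) → Le a (add a b)
  | .zero, _ => .refl ha
  | .succ _, h => (self_add ha h.of_succ).trans (.self_succ h.of_succ)
  | .limit _, h => .cocone 0 h (self_add ha (h.of_limit 0))

mutual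

theorem wf_add {a b : Raw} (ha : Wf a) : Wf b → Wf (add a b)
  | .zero => ha
  | .succ h => .succ (wf_add ha h)
  | .limit h h' => .limit (fun k => wf_add ha (h k)) (fun k => le_add ha (h' k))

theorem le_add {a b c : Raw} (ha : Wf a) : Le b c → Le (add a b) (add a c)
  | .zero h => .self_add ha (wf_add ha h)
  | .trans h₁ h₂ => .trans (le_add ha h₁) (le_add ha h₂)
  | .succ_mono h => .succ_mono (le_add ha h)
  | .cocone k h h' => .cocone k (wf_add ha h) (le_add ha h')
  | .limiting h h' => .limiting (wf_add ha h) fun k => le_add ha (h' k)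
  | .of_eqv h => .of_eqv (eqv_add ha h)

theorem eqv_add {a b c : Raw} (ha : Wf a) : Eqv b c → Eqv (add a b) (add a c)
  | .refl h => .refl (wf_add ha h)
  | .symm h => .symm (eqv_add ha h)
  | .trans h₁ h₂ => .trans (eqv_add ha h₁) (eqv_add ha h₂)
  | .succ h => .succ (eqv_add ha h)
  | .limit h h' e => .limit (wf_add ha h) (wf_add ha h') fun k => eqv_add ha (e k)
  | .bisim p q h h' e e' => .bisim p q (wf_add ha h) (wf_add ha h')
      (fun k => le_add ha (e k)) (fun k => le_add ha (e' k))

end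

theorem le_add_left {a a' : Raw} (h : Le a a') : ∀ {b : Raw}, Wf b → Le (add a b) (add a' b)
  | .zero, _ => h
  | .succ _, hb => .succ_mono (le_add_left h hb.of_succ)
  | .limit _, hb => .limiting (wf_add h.wf.1 hb) fun k =>
      .cocone k (wf_add h.wf.2 hb) (le_add_left h (hb.of_limit k))

theorem eqv_add_left {a a' : Raw} (h : Eqv a a') : ∀ {b : Raw}, Wf b → Eqv (add a b) (add a' b)
  | .zero, _ => h
  | .succ _, hb => .succ (eqv_add_left h hb.of_succ)
  | .limit _, hb => .limit (wf_add h.wf.1 hb) (wf_add h.wf.2 hb) fun k =>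
      eqv_add_left h (hb.of_limit k)

theorem zero_add : ∀ a : Raw, add zero a = a
  | .zero => rfl
  | .succ a => congrArg succ (zero_add a)
  | .limit f => congrArg limit (funext fun k => zero_add (f k))

theorem wf_nmul {a : Raw} (h : Wf a) : ∀ n, Wf (nmul a n)
  | 0 => .zero
  | n + 1 => wf_add (wf_nmul h n) h

theorem le_nmul {a b : Raw} (h : Le a b) : ∀ n, Le (nmul a n) (nmul b n)
  | 0 => .refl .zero
  | n + 1 => (le_add_left (le_nmul h n) h.wf.1).trans (le_add (wf_nmul h.wf.2 n) h)

theorem eqv_nmul {a b : Raw} (h : Eqv a b) : ∀ n, Eqv (nmul a n) (nmul b n)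
  | 0 => .refl .zero
  | n + 1 => (eqv_add_left (eqv_nmul h n) h.wf.1).trans (eqv_add (wf_nmul h.wf.2 n) h)

/-- If `1 ≤ a` then `a · ω` is a well-formed limit. -/
theorem wf_limit_nmul {a : Raw} (h : Le (succ zero) a) : Wf (limit fun n => nmul a n) :=
  .limit (wf_nmul h.wf.2) fun k => le_add (wf_nmul h.wf.2 k) h

theorem succ_le_limit_nmul {a : Raw} (h : Le (succ zero) a) :
    Le (succ a) (limit fun n => nmul a n) := by
  refine .cocone 2 (wf_limit_nmul h) ?_
  have e : nmul a 2 = add a a := by simp only [nmul, zero_add]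
  rw [e]
  exact le_add h.wf.2 h

theorem one_le_opow_limit {a : Raw} (h : Le (succ zero) a) :
    Le (succ zero) (limit fun n => nmul a n) :=
  (h.trans (.self_succ h.wf.2)).trans (succ_le_limit_nmul h)

mutual

theorem one_le_opow {a : Raw} : Wf a → Le (succ zero) (opow a)
  | .zero => .refl (.succ .zero)
  | .succ h => one_le_opow_limit (one_le_opow h)
  | .limit h h' => .cocone 0
      (.limit (fun k => (one_le_opow (h k)).wf.2) fun k =>
        (succ_le_limit_nmul (one_le_opow (h k))).trans (le_opow (h' k)).2)
      (one_le_opow (h 0))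

theorem le_opow {a b : Raw} : Le a b → Le (succ zero) (opow a) ∧ Le (opow a) (opow b)
  | .zero h => ⟨.refl (.succ .zero), one_le_opow h⟩
  | .trans h₁ h₂ => ⟨(le_opow h₁).1, (le_opow h₁).2.trans (le_opow h₂).2⟩
  | .succ_mono h =>
      have ih := le_opow h
      have hb := wf_limit_nmul (ih.1.trans ih.2)
      ⟨one_le_opow_limit ih.1, .limiting (wf_limit_nmul ih.1) fun k =>
        .cocone k hb (le_nmul ih.2 k)⟩
  | .cocone k h h' => ⟨(le_opow h').1, .cocone k (one_le_opow h).wf.2 (le_opow h').2⟩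
  | .limiting h h' => ⟨one_le_opow h, .limiting (one_le_opow h).wf.2 fun k => (le_opow (h' k)).2⟩
  | .of_eqv h => ⟨(eqv_opow h).1, .of_eqv (eqv_opow h).2⟩

theorem eqv_opow {a b : Raw} : Eqv a b → Le (succ zero) (opow a) ∧ Eqv (opow a) (opow b)
  | .refl h => ⟨one_le_opow h, .refl (one_le_opow h).wf.2⟩
  | .symm h => ⟨(eqv_opow h).1.trans (.of_eqv (eqv_opow h).2), (eqv_opow h).2.symm⟩
  | .trans h₁ h₂ => ⟨(eqv_opow h₁).1, (eqv_opow h₁).2.trans (eqv_opow h₂).2⟩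
  | .succ h =>
      have ih := eqv_opow h
      ⟨one_le_opow_limit ih.1, .limit (wf_limit_nmul ih.1)
        (wf_limit_nmul (ih.1.trans (.of_eqv ih.2))) (eqv_nmul ih.2)⟩
  | .limit h h' e => ⟨one_le_opow h, .limit (one_le_opow h).wf.2 (one_le_opow h').wf.2
      fun k => (eqv_opow (e k)).2⟩
  | .bisim p q h h' e e' => ⟨one_le_opow h, .bisim p q (one_le_opow h).wf.2 (one_le_opow h').wf.2
      (fun k => (le_opow (e k)).2) (fun k => (le_opow (e' k)).2)⟩

end

instance setoid : Setoid {a : Raw // Wf a} where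
  r a b := Eqv a.1 b.1
  iseqv := ⟨fun a => .refl a.2, .symm, .trans⟩

theorem le_congr {a a' b b' : Raw} (ha : Eqv a a') (hb : Eqv b b') : Le a b ↔ Le a' b' :=
  ⟨fun h => (Le.of_eqv ha.symm).trans (h.trans (.of_eqv hb)),
    fun h => (Le.of_eqv ha).trans (h.trans (.of_eqv hb.symm))⟩

end Raw

/-- Brouwer trees. -/
def Brw : Type := Quotient Raw.setoid

namespace Brw

instance : LE Brw :=
  ⟨Quotient.lift₂ (fun a b => Raw.Le a.1 b.1) fun _ _ _ _ ha hb => propext (Raw.le_congr ha hb)⟩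

def zero : Brw := Quotient.mk _ ⟨Raw.zero, .zero⟩

def succ : Brw → Brw :=
  Quotient.map (fun a => ⟨Raw.succ a.1, .succ a.2⟩) fun _ _ h => Raw.Eqv.succ h

instance : LT Brw := ⟨fun a b => succ a ≤ b⟩

theorem succ_out_le {a b : Brw} (h : a < b) : Raw.Le (Raw.succ a.out.1) b.out.1 := by
  rw [← Quotient.out_eq a, ← Quotient.out_eq b] at h
  exact h

/-- The limit of a strictly increasing sequence. -/
noncomputable def limit (f : ℕ → Brw) (hf : ∀ k, f k < f (k + 1)) : Brw :=
  Quotient.mk _ ⟨Raw.limit fun k => (f k).out.1,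
    .limit (fun k => (f k).out.2) fun k => succ_out_le (hf k)⟩

def add : Brw → Brw → Brw :=
  Quotient.map₂ (fun a b => ⟨Raw.add a.1 b.1, Raw.wf_add a.2 b.2⟩) fun _ a' ha b _ hb =>
    (Raw.eqv_add_left ha b.2).trans (Raw.eqv_add a'.2 hb)

/-- `ω ^ b`. -/
def opow : Brw → Brw :=
  Quotient.map (fun b => ⟨Raw.opow b.1, (Raw.one_le_opow b.2).wf.2⟩) fun _ _ h =>
    (Raw.eqv_opow h).2

end Brw

/-! ### The embedding, preservation of limits, Markov's principle -/

def CTree.toBrw : CTree → Brw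
  | .zero => Brw.zero
  | .node a b => Brw.add (Brw.opow a.toBrw) b.toBrw

def CtoB (a : Cnf) : Brw := a.1.toBrw

/-- `x` is the limit (least upper bound) of the strictly increasing sequence `f`. -/
def Cnf.IsLimitOf (x : Cnf) (f : ℕ → Cnf) : Prop :=
  (∀ n, f n ≤ x) ∧ ∀ c : Cnf, (∀ n, f n ≤ c) → x ≤ c

def CtoBPreservesLimits : Prop :=
  ∀ (f : ℕ → Cnf) (x : Cnf), (∀ n, f n < f (n + 1)) → x.IsLimitOf f →
    ∃ h : ∀ n, CtoB (f n) < CtoB (f (n + 1)), CtoB x = Brw.limit (fun n => CtoB (f n)) h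

def MarkovPrinciple : Prop :=
  ∀ s : ℕ → Bool, (¬ ∀ n, s n = false) → ∃ n, s n = true

/-! ### The same notions in Heyting-valued sets

For a complete Heyting algebra `H` we interpret the notions above in the universe of `H`-valued
sets (the sheaves on `H`), so that the truth value of a proposition is an element of `H`.
The types of natural numbers, of booleans and of Cantor normal forms are inductive types without
infinitary constructors and hence are interpreted as constant sheaves, with two-valued equality and
order.  Functions `ℕ → X` into a constant sheaf `X` are `H`-valued functional relations. -/

namespace Heyting

universe u

/-- The truth value of: the relation `f` is (the graph of) a function `ℕ → X`. -/
def isFun {H : Type u} [Order.Frame H] {X : Type} (f : ℕ → X → H) : H :=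
  ⨅ n, (⨆ x, f n x) ⊓ ⨅ x, ⨅ y, (f n x ⊓ f n y) ⇨ ⨆ _ : x = y, ⊤

/-- The truth value of Markov's principle. -/
def markov (H : Type u) [Order.Frame H] : H :=
  ⨅ s : ℕ → Bool → H, isFun s ⇨ (⨅ n, s n false)ᶜ ⇨ ⨆ n, s n true

/-- The truth value of: `f` is strictly increasing. -/
def cnfIncr {H : Type u} [Order.Frame H] (f : ℕ → Cnf → H) : H :=
  ⨅ n, ⨆ a, ⨆ b, ⨆ _ : a < b, f n a ⊓ f (n + 1) b

/-- The truth value of: `f n ≤ c` for all `n`. -/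
def cnfBound {H : Type u} [Order.Frame H] (f : ℕ → Cnf → H) (c : Cnf) : H :=
  ⨅ n, ⨆ a, ⨆ _ : a ≤ c, f n a

/-- The truth value of: `x` is the limit of `f`. -/
def cnfIsLimitOf {H : Type u} [Order.Frame H] (x : Cnf) (f : ℕ → Cnf → H) : H :=
  cnfBound f x ⊓ ⨅ c : Cnf, cnfBound f c ⇨ ⨆ _ : x ≤ c, ⊤

/-- Names for the elements of the sheaf of Brouwer trees: trees which may moreover be glued from
local data, `mix w b` being the tree that equals `b i` to the extent `w i`. -/
inductive Name (H : Type u) : Type (u + 1)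
  | zero : Name H
  | succ : Name H → Name H
  | limit : (ℕ → Name H) → Name H
  | mix : {I : Type u} → (I → H) → (I → Name H) → Name H

namespace Name

variable {H : Type u}

mutual

/-- `Wf u a`: on `u`, the name `a` denotes a Brouwer tree. -/
inductive Wf [Order.Frame H] : H → Name H → Prop
  | cover {I : Type u} {u : H} {a : Name H} (v : I → H) : u ≤ ⨆ i, v i → (∀ i, Wf (v i) a) → Wf u a
  | zero {u : H} : Wf u zero
  | succ {u : H} {a : Name H} : Wf u a → Wf u (succ a)
  | limit {u : H} {f : ℕ → Name H} : (∀ k, Wf u (f k)) →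
      (∀ k, Le u (succ (f k)) (f (k + 1))) → Wf u (limit f)
  | mix {u : H} {I : Type u} {w : I → H} {b : I → Name H} : u ≤ ⨆ i, w i →
      (∀ i, Wf (u ⊓ w i) (b i)) → (∀ i j, Eqv (u ⊓ (w i ⊓ w j)) (b i) (b j)) → Wf u (mix w b)

/-- `Le u a b`: the inequality `a ≤ b` holds on `u`. -/
inductive Le [Order.Frame H] : H → Name H → Name H → Prop
  | cover {I : Type u} {u : H} {a b : Name H} (v : I → H) : u ≤ ⨆ i, v i →
      (∀ i, Le (v i) a b) → Le u a b
  | zero {u : H} {a : Name H} : Wf u a → Le u zero a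
  | trans {u : H} {a b c : Name H} : Le u a b → Le u b c → Le u a c
  | succ_mono {u : H} {a b : Name H} : Le u a b → Le u (succ a) (succ b)
  | cocone {u : H} {a : Name H} {f : ℕ → Name H} (k : ℕ) : Wf u (limit f) → Le u a (f k) →
      Le u a (limit f)
  | limiting {u : H} {f : ℕ → Name H} {a : Name H} : Wf u (limit f) → (∀ k, Le u (f k) a) →
      Le u (limit f) a
  | of_eqv {u : H} {a b : Name H} : Eqv u a b → Le u a b

/-- `Eqv u a b`: the equality `a = b` holds on `u`. In `bisim`, the families `p` and `q` witness
that on `u` the sequences `f` and `g` simulate each other, `∃` being interpreted by coverings. -/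
inductive Eqv [Order.Frame H] : H → Name H → Name H → Prop
  | cover {I : Type u} {u : H} {a b : Name H} (v : I → H) : u ≤ ⨆ i, v i →
      (∀ i, Eqv (v i) a b) → Eqv u a b
  | refl {u : H} {a : Name H} : Wf u a → Eqv u a a
  | symm {u : H} {a b : Name H} : Eqv u a b → Eqv u b a
  | trans {u : H} {a b c : Name H} : Eqv u a b → Eqv u b c → Eqv u a c
  | succ {u : H} {a b : Name H} : Eqv u a b → Eqv u (succ a) (succ b)
  | limit {u : H} {f g : ℕ → Name H} : Wf u (limit f) → Wf u (limit g) →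
      (∀ k, Eqv u (f k) (g k)) → Eqv u (limit f) (limit g)
  | bisim {u : H} {f g : ℕ → Name H} (p q : ℕ → ℕ → H) : Wf u (limit f) → Wf u (limit g) →
      (∀ k, u ≤ ⨆ n, p k n) → (∀ k n, Le (p k n) (f k) (g n)) →
      (∀ k, u ≤ ⨆ n, q k n) → (∀ k n, Le (q k n) (g k) (f n)) → Eqv u (limit f) (limit g)
  | mix {u : H} {I : Type u} {w : I → H} {b : I → Name H} (i : I) : Wf u (mix w b) → u ≤ w i →
      Eqv u (mix w b) (b i)

end

/-- The truth value of the equality of two Brouwer trees. -/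
def eqVal [Order.Frame H] (a b : Name H) : H := sSup {u | Eqv u a b}

/-- Addition, by recursion on the second argument. -/
def add (a : Name H) : Name H → Name H
  | zero => a
  | succ b => succ (add a b)
  | limit f => limit fun k => add a (f k)
  | mix w b => mix w fun i => add a (b i)

/-- The finite multiple `a · n`. -/
def nmul (a : Name H) : ℕ → Name H
  | 0 => zero
  | n + 1 => add (nmul a n) a

/-- `ω ^ b`, where `ω ^ (b + 1) = ω ^ b · ω` is the limit of the `ω ^ b · n`. -/
def opow : Name H → Name H
  | zero => succ zero
  | succ b => limit fun n => nmul (opow b) n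
  | limit f => limit fun k => opow (f k)
  | mix w b => mix w fun i => opow (b i)

end Name

/-- The embedding on (constant) Cantor normal forms. -/
def treeToName (H : Type u) : CTree → Name H
  | .zero => .zero
  | .node a b => .add (.opow (treeToName H a)) (treeToName H b)

/-- The value of the embedding at the locally constant Cantor normal form that equals `c` to the
extent `w c`. -/
def ctob {H : Type u} (w : Cnf → H) : Name H :=
  .mix (I := ULift.{u} Cnf) (fun c => w c.down) fun c => treeToName H c.down.1

/-- The truth value of: the embedding preserves limits of strictly increasing sequences. -/
def preservesLimits (H : Type u) [Order.Frame H] : H :=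
  ⨅ f : ℕ → Cnf → H, ⨅ x : Cnf, isFun f ⇨ cnfIncr f ⇨ cnfIsLimitOf x f ⇨
    (treeToName H x.1).eqVal (.limit fun n => ctob (f n))

end Heyting

-- The order on Cantor normal forms is decidable and well-founded, and a form `x` that is the limit
-- of a strictly increasing sequence `f` has an explicit fundamental sequence `g` (`Fund`), which
-- the embedding turns literally into a Brouwer limit (`ofTree_fund`, `treeToName_fund`).
-- Preservation of the limit thus follows once `f` and `g` simulate each other. Each `f k` is
-- strictly below `x`, hence below some `g n`, and this `n` is computed (`Fund.exists_lt`). In the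
-- other direction, leastness of `x` says only that not every `f k` is `≤ g n`; extracting a `k`
-- with `g n < f k` is Markov's principle for a decidable predicate.
--
-- Conversely, given a binary sequence `s`, count 0, 1, 2, ... and jump from the `n`s to the `ω +
-- n`s once `s` has been true. If `s` is not constantly false, the supremum is `ω · 2`. If it is
-- preserved, then `ω < ω · 2` gives `ω <` some term, and that term is past the jump, so `s` has
-- been true. The last inference rests on a valuation of names that respects the generated equality
-- (`Eqv.val`).
--
-- Lean's logic proves Markov's principle outright, so the unrelativized equivalence needs one
-- direction only. The Heyting-valued statement runs both arguments with existentials read as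
-- coverings.

namespace CTree

-- The linear order on trees

theorem Lt.trans : ∀ {r s t : CTree}, Lt r s → Lt s t → Lt r t
  | _, _, _, .zero_node _ _, .left _ _ _ => .zero_node _ _
  | _, _, _, .zero_node _ _, .right _ _ => .zero_node _ _
  | _, _, _, .left _ _ h, .left _ _ h' => .left _ _ (h.trans h')
  | _, _, _, .left _ _ h, .right _ _ => .left _ _ h
  | _, _, _, .right _ _, .left _ _ h' => .left _ _ h'
  | _, _, _, .right _ h, .right _ h' => .right _ (h.trans h')

theorem Lt.irrefl : ∀ {t : CTree}, ¬ Lt t t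
  | .node _ _, .left _ _ h => h.irrefl
  | .node _ _, .right _ h => h.irrefl

theorem lt_trichotomy : ∀ s t : CTree, Lt s t ∨ s = t ∨ Lt t s
  | .zero, .zero => .inr (.inl rfl)
  | .zero, .node _ _ => .inl (.zero_node _ _)
  | .node _ _, .zero => .inr (.inr (.zero_node _ _))
  | .node a b, .node c d => by
      rcases lt_trichotomy a c with h | rfl | h
      · exact .inl (.left _ _ h)
      · rcases lt_trichotomy b d with h | rfl | h
        · exact .inl (.right _ h)
        · exact .inr (.inl rfl)
        · exact .inr (.inr (.right _ h))
      · exact .inr (.inr (.left _ _ h))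

theorem Le.refl (t : CTree) : Le t t := .inr rfl

theorem zero_le : ∀ t : CTree, Le zero t
  | .zero => .refl _
  | .node _ _ => .inl (.zero_node _ _)

theorem Lt.trans_le {r s t : CTree} (h : Lt r s) : Le s t → Lt r t
  | .inl h' => h.trans h'
  | .inr e => e ▸ h

theorem Le.trans_lt {r s t : CTree} (h : Le r s) (h' : Lt s t) : Lt r t := by
  rcases h with h | rfl
  exacts [h.trans h', h']

theorem Le.trans {r s t : CTree} (h : Le r s) (h' : Le s t) : Le r t := by
  rcases h' with h' | rfl
  exacts [.inl (h.trans_lt h'), h]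

theorem not_le {s t : CTree} : ¬ Le s t ↔ Lt t s := by
  refine ⟨fun h => ?_, fun h h' => (h.trans_le h').irrefl⟩
  rcases lt_trichotomy s t with h' | h' | h'
  exacts [absurd (.inl h') h, absurd (.inr h') h, h']

theorem Lt.left_le : ∀ {s t : CTree}, Lt s t → Le (CTree.left s) (CTree.left t)
  | _, _, .zero_node _ _ => zero_le _
  | _, _, .left _ _ h => .inl h
  | _, _, .right _ _ => .refl _

theorem IsCNF.exponent {a b : CTree} : IsCNF (CTree.node a b) → IsCNF a
  | .node h _ _ => h

theorem IsCNF.tail {a b : CTree} : IsCNF (CTree.node a b) → IsCNF b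
  | .node _ h _ => h

theorem IsCNF.left_tail_le {a b : CTree} : IsCNF (CTree.node a b) → Le (CTree.left b) a
  | .node _ _ h => h

/-! #### Well-foundedness -/

/-- The order restricted to normal forms. -/
def CnfLt (s t : CTree) : Prop := IsCNF s ∧ Lt s t

/-- The tail of a normal form has leading exponent at most that of the whole, so recursion on the
tail stays below `a`. Without normality accessibility fails: prefixing `ω ^ 0 +` to `ω ^ 1`
repeatedly gives an infinite descent. -/
theorem acc_of_left_lt {a : CTree}
    (ih : ∀ a', CnfLt a' a → ∀ b, Acc CnfLt b → IsCNF (node a' b) → Acc CnfLt (node a' b)) :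
    ∀ c : CTree, IsCNF c → Lt (left c) a → Acc CnfLt c
  | .zero, _, _ => ⟨_, fun _ h => nomatch h.2⟩
  | .node a' b', hc, h =>
      ih a' ⟨hc.exponent, h⟩ b' (acc_of_left_lt ih b' hc.tail (hc.left_tail_le.trans_lt h)) hc

/-- Nested induction, on the exponent and then on the tail. A predecessor with a smaller exponent
may have a tail larger than `b`, which is what `acc_of_left_lt` handles. -/
theorem acc_node {a : CTree} (ha : Acc CnfLt a) :
    ∀ b, Acc CnfLt b → IsCNF (node a b) → Acc CnfLt (node a b) := by
  induction ha with
  | intro a _ iha =>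
    intro b hb
    induction hb with
    | intro b _ ihb =>
      intro _
      refine ⟨_, ?_⟩
      rintro _ ⟨hs, h⟩
      cases h with
      | zero_node => exact ⟨_, fun _ h => nomatch h.2⟩
      | left _ _ h => exact acc_of_left_lt iha _ hs h
      | right _ h => exact ihb _ ⟨hs.tail, h⟩ hs

theorem IsCNF.acc : ∀ {t : CTree}, IsCNF t → Acc CnfLt t
  | .zero, _ => ⟨_, fun _ h => nomatch h.2⟩
  | .node _ _, h => acc_node h.exponent.acc _ h.tail.acc h

/-! #### Successors and fundamental sequences -/

/-- The successor `t + 1`. -/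
def succ : CTree → CTree
  | zero => node zero zero
  | node a b => node a (succ b)

theorem left_succ : ∀ t : CTree, left (succ t) = left t
  | .zero => rfl
  | .node _ _ => rfl

theorem IsCNF.of_succ : ∀ {t : CTree}, IsCNF (succ t) → IsCNF t
  | .zero, _ => .zero
  | .node _ b, h => .node h.exponent h.tail.of_succ (left_succ b ▸ h.left_tail_le)

theorem IsCNF.succ : ∀ {t : CTree}, IsCNF t → IsCNF (CTree.succ t)
  | .zero, h => .node h h (.refl _)
  | .node _ b, h => .node h.exponent h.tail.succ ((left_succ b).symm ▸ h.left_tail_le)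

theorem lt_succ : ∀ t : CTree, Lt t (succ t)
  | .zero => .zero_node _ _
  | .node _ b => .right _ (lt_succ b)

theorem le_of_lt_succ : ∀ {s t : CTree}, Lt s (succ t) → Le s t
  | .zero, _, _ => zero_le _
  | .node _ _, .zero, .left _ _ h => nomatch h
  | .node _ _, .zero, .right _ h => nomatch h
  | .node _ _, .node _ _, .left _ _ h => .inl (.left _ _ h)
  | .node _ _, .node _ _, .right _ h => (le_of_lt_succ h).elim (fun h => .inl (.right _ h))
      fun e => e ▸ .refl _

/-- The finite multiple `ω ^ a · n`. -/
def powMul (a : CTree) : ℕ → CTree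
  | 0 => zero
  | n + 1 => node a (powMul a n)

/-- `Fund t g`: the sequence `g` is the fundamental sequence of the limit `t`. -/
inductive Fund : CTree → (ℕ → CTree) → Prop
  | tail (a : CTree) {b : CTree} {h : ℕ → CTree} : Fund b h → Fund (node a b) fun n => node a (h n)
  | pow_succ (a : CTree) : Fund (node (succ a) zero) (powMul a)
  | pow {a : CTree} {h : ℕ → CTree} : Fund a h → Fund (node a zero) fun n => node (h n) zero

theorem zero_or_succ_or_fund : ∀ t : CTree, t = zero ∨ (∃ s, t = succ s) ∨ ∃ g, Fund t g
  | .zero => .inl rfl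
  | .node a b => by
      rcases zero_or_succ_or_fund b with rfl | ⟨s, rfl⟩ | ⟨h, hb⟩
      · rcases zero_or_succ_or_fund a with rfl | ⟨s, rfl⟩ | ⟨h, ha⟩
        · exact .inr (.inl ⟨zero, rfl⟩)
        · exact .inr (.inr ⟨_, .pow_succ s⟩)
        · exact .inr (.inr ⟨_, .pow ha⟩)
      · exact .inr (.inl ⟨node a s, rfl⟩)
      · exact .inr (.inr ⟨_, .tail a hb⟩)

theorem left_powMul_le (a : CTree) : ∀ n, Le (left (powMul a n)) a
  | 0 => zero_le _
  | _ + 1 => .refl _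

theorem isCNF_powMul {a : CTree} (h : IsCNF a) : ∀ n, IsCNF (powMul a n)
  | 0 => .zero
  | n + 1 => .node h (isCNF_powMul h n) (left_powMul_le a n)

theorem powMul_lt_powMul (a : CTree) : ∀ n, Lt (powMul a n) (powMul a (n + 1))
  | 0 => .zero_node _ _
  | n + 1 => .right _ (powMul_lt_powMul a n)

theorem powMul_lt_pow_succ (a : CTree) : ∀ n, Lt (powMul a n) (node (succ a) zero)
  | 0 => .zero_node _ _
  | _ + 1 => .left _ _ (lt_succ a)

/-- The witness is one more than the number of leading terms of `c` with exponent exactly `a`;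
normality makes all later exponents smaller. -/
theorem exists_lt_powMul {a : CTree} : ∀ {c : CTree}, IsCNF c → Le (left c) a →
    ∃ n, Lt c (powMul a n)
  | .zero, _, _ => ⟨1, .zero_node _ _⟩
  | .node _ _, _, .inl h => ⟨1, .left _ _ h⟩
  | .node _ _, hc, .inr e => by
      subst e
      obtain ⟨n, hn⟩ := exists_lt_powMul hc.tail hc.left_tail_le
      exact ⟨n + 1, .right _ hn⟩

namespace Fund

variable {t : CTree} {g : ℕ → CTree}

theorem lt (h : Fund t g) (n : ℕ) : Lt (g n) t := by
  induction h with
  | tail a _ ih => exact .right _ ih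
  | pow_succ a => exact powMul_lt_pow_succ a n
  | pow _ ih => exact .left _ _ ih

theorem incr (h : Fund t g) (n : ℕ) : Lt (g n) (g (n + 1)) := by
  induction h with
  | tail a _ ih => exact .right _ ih
  | pow_succ a => exact powMul_lt_powMul a n
  | pow _ ih => exact .left _ _ ih

theorem isCNF (h : Fund t g) (ht : IsCNF t) (n : ℕ) : IsCNF (g n) := by
  induction h with
  | tail a hb ih =>
    exact .node ht.exponent (ih ht.tail) ((hb.lt n).left_le.trans ht.left_tail_le)
  | pow_succ a => exact isCNF_powMul ht.exponent.of_succ n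
  | pow _ ih => exact .node (ih ht.exponent) .zero (zero_le _)

/-- Cofinality of fundamental sequences. The index is read off from `c`, so this half of the
simulation needs no Markov principle. -/
theorem exists_lt (h : Fund t g) : ∀ {c : CTree}, IsCNF c → Lt c t → ∃ n, Lt c (g n) := by
  induction h with
  | tail a _ ih =>
    rintro _ hc (_ | ⟨_, _, h⟩ | ⟨_, h⟩)
    · exact ⟨0, .zero_node _ _⟩
    · exact ⟨0, .left _ _ h⟩
    · exact (ih hc.tail h).imp fun _ h => .right _ h
  | pow_succ a =>
    rintro _ hc (_ | ⟨_, _, h⟩ | ⟨_, h⟩)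
    · exact ⟨1, .zero_node _ _⟩
    · exact exists_lt_powMul hc (le_of_lt_succ h)
    · cases h
  | pow _ ih =>
    rintro _ hc (_ | ⟨_, _, h⟩ | ⟨_, h⟩)
    · exact ⟨0, .zero_node _ _⟩
    · exact (ih hc.exponent h).imp fun _ h => .left _ _ h
    · cases h

end Fund

end CTree

-- The embedding into raw trees

namespace Raw

/-- The embedding into raw trees. -/
def ofTree : CTree → Raw
  | .zero => .zero
  | .node a b => add (opow (ofTree a)) (ofTree b)

theorem add_assoc (a b : Raw) : ∀ c, add (add a b) c = add a (add b c)
  | .zero => rfl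
  | .succ c => congrArg succ (add_assoc a b c)
  | .limit f => congrArg limit (funext fun k => add_assoc a b (f k))

/-- `nmul` appends a summand whereas `CTree.powMul` prepends one; this reconciles them. -/
theorem nmul_succ' (a : Raw) : ∀ n, nmul a (n + 1) = add a (nmul a n)
  | 0 => zero_add a
  | n + 1 => by
    change add (nmul a (n + 1)) a = add a (add (nmul a n) a)
    rw [nmul_succ' a n, add_assoc]

theorem ofTree_succ : ∀ t : CTree, ofTree t.succ = succ (ofTree t)
  | .zero => rfl
  | .node a b => by simp only [CTree.succ, ofTree, ofTree_succ b, add]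

theorem ofTree_powMul (a : CTree) : ∀ n, ofTree (a.powMul n) = nmul (opow (ofTree a)) n
  | 0 => rfl
  | n + 1 => by rw [nmul_succ', ← ofTree_powMul a n]; rfl

/-- An identity of raw trees, not merely up to `Eqv`: the constructors of `Fund` mirror the limit
clauses of `add` and `opow`. -/
theorem ofTree_fund {t : CTree} {g : ℕ → CTree} (h : t.Fund g) :
    ofTree t = limit fun n => ofTree (g n) := by
  induction h with
  | tail a _ ih => simp only [ofTree, ih, add]
  | pow_succ a => simp only [ofTree, ofTree_succ, ofTree_powMul, opow, add]
  | pow _ ih => simp only [ofTree, ih, opow, add]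

theorem wf_ofTree : ∀ t : CTree, Wf (ofTree t)
  | .zero => .zero
  | .node a b => wf_add (one_le_opow (wf_ofTree a)).wf.2 (wf_ofTree b)

theorem succ_ofTree_le {t : CTree} (ht : t.IsCNF) :
    ∀ {s : CTree}, s.IsCNF → s.Lt t → Le (succ (ofTree s)) (ofTree t) := by
  induction ht.acc with
  | intro t _ ih =>
    intro s hs h
    have wf := wf_ofTree t
    rcases t.zero_or_succ_or_fund with rfl | ⟨r, rfl⟩ | ⟨g, hg⟩
    · cases h
    · rw [ofTree_succ]
      refine .succ_mono ?_
      rcases CTree.le_of_lt_succ h with h | rfl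
      · exact (Le.self_succ (wf_ofTree s)).trans
          (ih r ⟨ht.of_succ, r.lt_succ⟩ ht.of_succ hs h)
      · exact .refl (wf_ofTree s)
    · obtain ⟨n, hn⟩ := hg.exists_lt hs h
      rw [ofTree_fund hg] at wf ⊢
      exact .cocone n wf (ih _ ⟨hg.isCNF ht n, hg.lt n⟩ (hg.isCNF ht n) hs hn)

theorem ofTree_le {s t : CTree} (hs : s.IsCNF) (ht : t.IsCNF) (h : s.Lt t) :
    Le (ofTree s) (ofTree t) :=
  (Le.self_succ (wf_ofTree s)).trans (succ_ofTree_le ht hs h)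

end Raw

-- Preservation of limits in Brouwer trees

theorem CTree.toBrw_eq : ∀ t : CTree, t.toBrw = Quotient.mk _ ⟨Raw.ofTree t, Raw.wf_ofTree t⟩
  | .zero => rfl
  | .node a b => by rw [CTree.toBrw, toBrw_eq a, toBrw_eq b]; rfl

theorem CtoB_lt {a b : Cnf} (h : a < b) : CtoB a < CtoB b := by
  change Brw.succ a.1.toBrw ≤ b.1.toBrw
  rw [CTree.toBrw_eq, CTree.toBrw_eq]
  exact Raw.succ_ofTree_le b.2 a.2 h

/-- `Brw.limit` is built from chosen representatives; this compares them with the explicit ones. -/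
theorem eqv_CtoB_out (a : Cnf) : Raw.Eqv (CtoB a).out.1 (Raw.ofTree a.1) :=
  Quotient.exact ((Quotient.out_eq (CtoB a)).trans a.1.toBrw_eq)

/-- A normal form that is the limit of a strictly increasing sequence has a fundamental sequence. -/
theorem Cnf.IsLimitOf.exists_fund {f : ℕ → Cnf} {x : Cnf} (hf : ∀ n, f n < f (n + 1))
    (hx : x.IsLimitOf f) : ∃ g, x.1.Fund g := by
  have lt (n) : CTree.Lt (f n).1 x.1 := CTree.Lt.trans_le (hf n) (hx.1 (n + 1))
  rcases x.1.zero_or_succ_or_fund with h | ⟨s, h⟩ | h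
  · exact absurd (CTree.zero_le (f 0).1) (CTree.not_le.2 (h ▸ lt 0))
  · have hs : s.IsCNF := (h ▸ x.2 : s.succ.IsCNF).of_succ
    have : CTree.Le x.1 s := hx.2 ⟨s, hs⟩ fun n => CTree.le_of_lt_succ (h ▸ lt n)
    exact absurd this (CTree.not_le.2 (h ▸ s.lt_succ))
  · exact h

theorem CtoBPreservesLimits.of_markov (mp : MarkovPrinciple) : CtoBPreservesLimits := by
  classical
  intro f x hf hx
  refine ⟨fun n => CtoB_lt (hf n), ?_⟩
  obtain ⟨g, hg⟩ := hx.exists_fund hf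
  have above (n) : ∃ k, CTree.Lt (g n) (f k).1 := by
    -- If no `f k` exceeded `g n`, then `g n < x` would be an upper bound.
    obtain ⟨k, hk⟩ := mp (fun k => decide (CTree.Lt (g n) (f k).1)) fun h =>
      CTree.not_le.2 (hg.lt n) (hx.2 ⟨g n, hg.isCNF x.2 n⟩ fun k =>
        not_imp_comm.1 CTree.not_le.1 (of_decide_eq_false (h k)))
    exact ⟨k, of_decide_eq_true hk⟩
  have below (n) : ∃ k, CTree.Lt (f n).1 (g k) :=
    hg.exists_lt (f n).2 (CTree.Lt.trans_le (hf n) (hx.1 (n + 1)))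
  choose p hp using above
  choose q hq using below
  refine (CTree.toBrw_eq _).trans (Quotient.sound ?_)
  have wf := Raw.wf_ofTree x.1
  change Raw.Eqv (Raw.ofTree x.1) _
  rw [Raw.ofTree_fund hg] at wf ⊢
  exact .bisim p q wf
    (.limit (fun k => (CtoB (f k)).out.2) fun k => Brw.succ_out_le (CtoB_lt (hf k)))
    (fun k => (Raw.ofTree_le (hg.isCNF x.2 k) (f _).2 (hp k)).trans
      (.of_eqv (eqv_CtoB_out _).symm))
    (fun k => (Raw.Le.of_eqv (eqv_CtoB_out _)).trans
      (Raw.ofTree_le (f k).2 (hg.isCNF x.2 _) (hq k)))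

theorem markovPrinciple : MarkovPrinciple := fun _ h =>
  (not_forall.1 h).imp fun _ => Bool.eq_true_of_not_eq_false

-- Names of Cantor normal forms over a Heyting algebra

namespace Heyting

universe u

namespace Name

variable {H : Type u}

theorem add_assoc (a b : Name H) : ∀ c, add (add a b) c = add a (add b c)
  | .zero => rfl
  | .succ c => congrArg succ (add_assoc a b c)
  | .limit f => congrArg limit (funext fun k => add_assoc a b (f k))
  | .mix w c => congrArg (mix w) (funext fun i => add_assoc a b (c i))

theorem zero_add : ∀ a : Name H, add zero a = a
  | .zero => rfl
  | .succ a => congrArg succ (zero_add a)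
  | .limit f => congrArg limit (funext fun k => zero_add (f k))
  | .mix w c => congrArg (mix w) (funext fun i => zero_add (c i))

theorem nmul_succ' (a : Name H) : ∀ n, nmul a (n + 1) = add a (nmul a n)
  | 0 => zero_add a
  | n + 1 => by
    change add (nmul a (n + 1)) a = add a (add (nmul a n) a)
    rw [nmul_succ' a n, add_assoc]

end Name

theorem treeToName_succ (H : Type u) :
    ∀ t : CTree, treeToName H t.succ = .succ (treeToName H t)
  | .zero => rfl
  | .node a b => by simp only [CTree.succ, treeToName, treeToName_succ H b, Name.add]

theorem treeToName_powMul (H : Type u) (a : CTree) :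
    ∀ n, treeToName H (a.powMul n) = .nmul (.opow (treeToName H a)) n
  | 0 => rfl
  | n + 1 => by rw [Name.nmul_succ', ← treeToName_powMul H a n]; rfl

theorem treeToName_fund (H : Type u) {t : CTree} {g : ℕ → CTree} (h : t.Fund g) :
    treeToName H t = .limit fun n => treeToName H (g n) := by
  induction h with
  | tail a _ ih => simp only [treeToName, ih, Name.add]
  | pow_succ a => simp only [treeToName, treeToName_succ, treeToName_powMul, Name.opow, Name.add]
  | pow _ ih => simp only [treeToName, ih, Name.opow, Name.add]

variable {H : Type u} [Order.Frame H]

namespace Name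

variable {u v : H} {a b : Name H}

theorem Wf.mono (h : Wf u a) (hv : v ≤ u) : Wf v a :=
  .cover (fun _ : PUnit => u) (hv.trans (le_iSup (fun _ : PUnit => u) ⟨⟩)) fun _ => h

theorem Le.mono (h : Le u a b) (hv : v ≤ u) : Le v a b :=
  .cover (fun _ : PUnit => u) (hv.trans (le_iSup (fun _ : PUnit => u) ⟨⟩)) fun _ => h

/-- The empty family covers `⊥`. This is how contradictory cases are discharged internally. -/
theorem Eqv.of_le_bot (h : u ≤ ⊥) : Eqv u a b :=
  .cover (fun i : PEmpty => i.elim) (h.trans bot_le) nofun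

end Name

open Name

/-- On normal forms the embedding is well formed, and strictly increasing. -/
theorem treeToName_spec {t : CTree} (ht : t.IsCNF) :
    Wf (⊤ : H) (treeToName H t) ∧ Le (⊤ : H) (treeToName H t) (.succ (treeToName H t)) ∧
      ∀ {s : CTree}, s.IsCNF → s.Lt t → Le (⊤ : H) (.succ (treeToName H s)) (treeToName H t) := by
  induction ht.acc with
  | intro t _ ih =>
    rcases t.zero_or_succ_or_fund with rfl | ⟨r, rfl⟩ | ⟨g, hg⟩
    · exact ⟨.zero, .zero (.succ .zero), nofun⟩
    · have hr := ht.of_succ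
      obtain ⟨wf, le, lt⟩ := ih r ⟨hr, r.lt_succ⟩ hr
      rw [treeToName_succ]
      refine ⟨.succ wf, .succ_mono le, fun {s} hs h => .succ_mono ?_⟩
      rcases CTree.le_of_lt_succ h with h' | rfl
      · exact (ih s ⟨hs, h⟩ hs).2.1.trans (lt hs h')
      · exact .of_eqv (.refl wf)
    · have hn (n) := hg.isCNF ht n
      have ih (n) := ih (g n) ⟨hn n, hg.lt n⟩ (hn n)
      rw [treeToName_fund H hg]
      have wf : Wf (⊤ : H) (.limit fun n => treeToName H (g n)) :=
        .limit (fun n => (ih n).1) fun n => (ih (n + 1)).2.2 (hn n) (hg.incr n)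
      refine ⟨wf, .limiting wf fun n => (ih n).2.1.trans
        (.succ_mono (.cocone n wf (.of_eqv (.refl (ih n).1)))), fun hs h => ?_⟩
      obtain ⟨n, h⟩ := hg.exists_lt hs h
      exact .cocone n wf ((ih n).2.2 hs h)

theorem wf_treeToName {t : CTree} (ht : t.IsCNF) (u : H) : Wf u (treeToName H t) :=
  (treeToName_spec ht).1.mono le_top

theorem succ_treeToName_le {s t : CTree} (hs : s.IsCNF) (ht : t.IsCNF) (h : s.Lt t) (u : H) :
    Le u (.succ (treeToName H s)) (treeToName H t) :=
  ((treeToName_spec ht).2.2 hs h).mono le_top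

theorem treeToName_le {s t : CTree} (hs : s.IsCNF) (ht : t.IsCNF) (h : s.Lt t) (u : H) :
    Le u (treeToName H s) (treeToName H t) :=
  ((treeToName_spec hs).2.1.mono le_top).trans (succ_treeToName_le hs ht h u)

/-! ### Functional relations -/

section isFun

variable {X : Type} {f : ℕ → X → H} {u : H}

theorem le_isFun_iff : u ≤ isFun f ↔
    ∀ n, u ≤ ⨆ x, f n x ∧ ∀ x y, x ≠ y → u ⊓ (f n x ⊓ f n y) ≤ ⊥ := by
  simp only [isFun, le_iInf_iff, le_inf_iff, le_himp_iff]
  refine forall_congr' fun n => and_congr_right fun _ => forall₂_congr fun x y => ?_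
  by_cases h : x = y <;> simp [h]

end isFun

theorem wf_ctob {u : H} {w : Cnf → H} (h : u ≤ ⨆ c, w c)
    (h' : ∀ c d, c ≠ d → u ⊓ (w c ⊓ w d) ≤ ⊥) : Wf u (ctob w) := by
  refine .mix ?_ (fun c => wf_treeToName c.down.2 _) fun ⟨c⟩ ⟨d⟩ => ?_
  · exact h.trans (iSup_le fun c => le_iSup (fun c : ULift.{u} Cnf => w c.down) ⟨c⟩)
  · by_cases e : c = d
    · subst e
      exact .refl (wf_treeToName c.2 _)
    · exact .of_le_bot (h' c d e)

theorem eqv_ctob {u v : H} {w : Cnf → H} (h : Wf u (ctob w)) (c : Cnf) (hv : v ≤ u)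
    (hc : v ≤ w c) : Eqv v (ctob w) (treeToName H c.1) :=
  .mix (I := ULift.{u} Cnf) ⟨c⟩ (h.mono hv) hc

/-! ### Elimination of coverings -/

/-- Internal elimination of an existential, by frame distributivity: it suffices to argue on each
piece of the covering. -/
theorem le_of_cover {I : Sort*} {w : I → H} {u z : H} (h : u ≤ ⨆ i, w i)
    (h' : ∀ i, ∀ v ≤ u, v ≤ w i → v ≤ z) : u ≤ z := by
  refine (le_inf le_rfl h).trans ?_
  rw [inf_iSup_eq]
  exact iSup_le fun i => h' i _ inf_le_left inf_le_right

theorem le_of_le_sup {u x y z : H} (h : u ≤ x ⊔ y) (hx : ∀ v ≤ u, v ≤ x → v ≤ z)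
    (hy : ∀ v ≤ u, v ≤ y → v ≤ z) : u ≤ z := by
  refine (le_inf le_rfl h).trans ?_
  rw [inf_sup_left]
  exact sup_le (hx _ inf_le_left inf_le_right) (hy _ inf_le_left inf_le_right)

/-- The truth value of: the element named by `w` satisfies the predicate `p`. -/
def holds {X : Type} (w : X → H) (p : X → Prop) : H := ⨆ c, ⨆ _ : p c, w c

section holds

variable {X : Type} {w : X → H} {p q : X → Prop} {u z : H} {a b : Name H}

theorem le_holds {c : X} (h : p c) : w c ≤ holds w p :=
  le_iSup₂_of_le c h le_rfl

theorem le_of_holds (h : u ≤ holds w p) (h' : ∀ c, p c → ∀ v ≤ u, v ≤ w c → v ≤ z) : u ≤ z :=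
  le_of_cover h fun c _ hv h₁ => le_of_cover h₁ fun hc _ hv' => h' c hc _ (hv'.trans hv)

/-- The order on names is a generated relation rather than an element of `H`, so its `cover`
constructor replaces distributivity. -/
theorem Name.Le.of_holds (h : u ≤ holds w p) (h' : ∀ c, p c → ∀ v ≤ u, v ≤ w c → Le v a b) :
    Le u a b :=
  .cover (fun c : ULift.{u} {c // p c} => u ⊓ w c.down.1)
    (le_of_holds h fun c hc _ hv h₁ => (le_inf hv h₁).trans
      (le_iSup (fun c : ULift.{u} {c // p c} => u ⊓ w c.down.1) ⟨⟨c, hc⟩⟩))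
    fun c => h' c.down.1 c.down.2 _ inf_le_left inf_le_right

theorem inf_holds_inf_holds_le (h' : ∀ c d, c ≠ d → u ⊓ (w c ⊓ w d) ≤ ⊥)
    (h : ∀ c, p c → ¬ q c) : u ⊓ (holds w p ⊓ holds w q) ≤ ⊥ :=
  le_of_holds (inf_le_right.trans inf_le_left) fun c hc _ hv h₁ =>
    le_of_holds (hv.trans (inf_le_right.trans inf_le_right)) fun d hd _ hv' h₂ =>
      (le_inf (hv'.trans (hv.trans inf_le_left)) (le_inf (hv'.trans h₁) h₂)).trans
        (h' c d fun e => h c hc (e ▸ hd))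

end holds

/-- The image of a functional relation under a sequence of functions. -/
theorem isFun_le_isFun_map {X Y : Type} (f : ℕ → X → H) (e : ℕ → X → Y) :
    isFun f ≤ isFun fun n y => holds (f n) fun x => e n x = y := by
  have hf := le_isFun_iff.1 (le_refl (isFun f))
  refine le_isFun_iff.2 fun n => ⟨?_, fun x y h => ?_⟩
  · exact (hf n).1.trans (iSup_le fun x =>
      le_iSup_of_le (e n x) (le_holds (p := fun x' => e n x' = e n x) rfl))
  · exact inf_holds_inf_holds_le (hf n).2 fun c hc hc' => h (hc.symm.trans hc')

/-! ### Markov's principle implies preservation of limits -/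

section

variable {u : H} {f : ℕ → Cnf → H} {x : Cnf}

/-- Well-formedness of this limit carries the clause that the image sequence is strictly increasing.
-/
theorem wf_limit_ctob (hf : u ≤ isFun f) (hi : u ≤ cnfIncr f) :
    Wf u (.limit fun n => ctob (f n)) := by
  have hf := le_isFun_iff.1 hf
  have wf (n) := wf_ctob (hf n).1 (hf n).2
  refine .limit wf fun n => ?_
  have h : u ≤ holds (fun c : Cnf × Cnf => f n c.1 ⊓ f (n + 1) c.2) fun c => c.1 < c.2 :=
    (hi.trans (iInf_le _ n)).trans (iSup_le fun a => iSup_le fun b => iSup_le fun hab =>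
      le_holds (w := fun c : Cnf × Cnf => f n c.1 ⊓ f (n + 1) c.2)
        (p := fun c => c.1 < c.2) (c := (a, b)) hab)
  refine .of_holds h fun c hc v hv hw => ?_
  exact (Le.of_eqv (eqv_ctob (wf n) c.1 hv (hw.trans inf_le_left)).succ).trans
    ((succ_treeToName_le c.1.2 c.2.2 hc v).trans
      (.of_eqv (eqv_ctob (wf (n + 1)) c.2 hv (hw.trans inf_le_right)).symm))

theorem le_holds_lt (hf : u ≤ isFun f) (hi : u ≤ cnfIncr f) (hx : u ≤ cnfBound f x) (n : ℕ) :
    u ≤ holds (f n) (· < x) := by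
  have hf := (le_isFun_iff.1 hf (n + 1)).2
  refine le_of_cover (hi.trans (iInf_le _ n)) fun a v hva h => ?_
  refine le_of_cover h fun b v hvb h => le_of_cover h fun hab v hvc h => ?_
  have hv := hvc.trans (hvb.trans hva)
  refine le_of_holds (hv.trans (hx.trans (iInf_le _ (n + 1)))) fun c hc v hvd h' => ?_
  -- Both are values of `f (n + 1)`, so where they differ single-valuedness leaves only `⊥`.
  by_cases e : b = c
  · exact (hvd.trans (h.trans inf_le_left)).trans
      (le_holds (p := (· < x)) (CTree.Lt.trans_le hab (e ▸ hc)))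
  · exact ((le_inf (hvd.trans hv) (le_inf (hvd.trans (h.trans inf_le_right)) h')).trans
      (hf b c e)).trans bot_le

/-- The order on the constant sheaf is two-valued, so `x ≤ c` has truth value `⊥`. -/
theorem inf_cnfBound_le_bot (hx : u ≤ cnfIsLimitOf x f) {c : Cnf} (hc : CTree.Lt c.1 x.1) :
    u ⊓ cnfBound f c ≤ ⊥ := by
  rw [← le_himp_iff]
  refine (hx.trans inf_le_right).trans ((iInf_le _ c).trans (himp_le_himp_left ?_))
  exact iSup_le fun h => absurd h (CTree.not_le.2 hc)

theorem le_cnfBound {c : Cnf} (h : ∀ n, u ≤ holds (f n) (· ≤ c)) : u ≤ cnfBound f c :=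
  le_iInf h

/-- The only use of Markov's principle in the internal argument, applied to the sequence of
decisions whether `c < f k`. -/
theorem le_iSup_holds_gt (mp : u ≤ markov H) (hf : u ≤ isFun f) (hx : u ≤ cnfIsLimitOf x f)
    {c : Cnf} (hc : c < x) : u ≤ ⨆ k, holds (f k) (c < ·) := by
  classical
  let s : ℕ → Bool → H := fun k b => holds (f k) fun d => decide (c < d) = b
  have hs : u ≤ isFun s := hf.trans (isFun_le_isFun_map f fun _ d => decide (c < d))
  have hn : u ≤ (⨅ k, s k false)ᶜ := by
    rw [le_compl_iff_disjoint_right, disjoint_iff_inf_le]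
    refine (le_inf inf_le_left (le_cnfBound fun k =>
      inf_le_right.trans ((iInf_le _ k).trans ?_))).trans (inf_cnfBound_le_bot hx hc)
    exact le_of_holds le_rfl fun d hd v _ h => h.trans
      (le_holds (p := (· ≤ c)) (not_imp_comm.1 CTree.not_le.1 (of_decide_eq_false hd)))
  have h := le_himp_iff.1 (le_himp_iff.1 (mp.trans (iInf_le _ s)))
  refine (le_inf (le_inf le_rfl hs) hn).trans (h.trans (iSup_mono fun k => ?_))
  exact le_of_holds le_rfl fun d hd v _ h => h.trans
    (le_holds (p := (c < ·)) (of_decide_eq_true hd))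

theorem eqv_limit_ctob (mp : u ≤ markov H) (hf : u ≤ isFun f) (hi : u ≤ cnfIncr f)
    (hx : u ≤ cnfIsLimitOf x f) : Eqv u (treeToName H x.1) (.limit fun n => ctob (f n)) := by
  have lt := le_holds_lt hf hi (hx.trans inf_le_left)
  rcases x.1.zero_or_succ_or_fund with h | ⟨s, h⟩ | ⟨g, hg⟩
  · exact .of_le_bot (le_of_holds (lt 0) fun c hc _ _ _ =>
      absurd (CTree.zero_le c.1) (CTree.not_le.2 (h ▸ hc)))
  · let y : Cnf := ⟨s, (h ▸ x.2 : s.succ.IsCNF).of_succ⟩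
    have hb : u ≤ cnfBound f y := le_cnfBound fun n => le_of_holds (lt n) fun c hc _ _ h' => by
      have hc : CTree.Lt c.1 x.1 := hc
      rw [h] at hc
      exact h'.trans (le_holds (p := (· ≤ y)) (CTree.le_of_lt_succ hc))
    exact .of_le_bot ((le_inf le_rfl hb).trans (inf_cnfBound_le_bot hx (h ▸ s.lt_succ)))
  · have wfx := wf_treeToName x.2 u
    have hn := hg.isCNF x.2
    let y (n : ℕ) : Cnf := ⟨g n, hn n⟩
    rw [treeToName_fund H hg] at wfx ⊢
    have wf (n) := wf_ctob (le_isFun_iff.1 hf n).1 (le_isFun_iff.1 hf n).2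
    refine .bisim (fun n k => u ⊓ holds (f k) (y n < ·))
      (fun k n => u ⊓ holds (f k) (· < y n)) wfx (wf_limit_ctob hf hi)
      (fun n => ?_) (fun n k => ?_) (fun k => ?_) (fun k n => ?_)
    · rw [← inf_iSup_eq]
      exact le_inf le_rfl (le_iSup_holds_gt mp hf hx (hg.lt n))
    · exact .of_holds inf_le_right fun c hc v hv h =>
        (treeToName_le (hn n) c.2 hc v).trans
          (.of_eqv (eqv_ctob (wf k) c (hv.trans inf_le_left) h).symm)
    · rw [← inf_iSup_eq]
      refine le_inf le_rfl (le_of_holds (lt k) fun c hc v _ h => ?_)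
      obtain ⟨n, hc⟩ := hg.exists_lt c.2 hc
      exact le_iSup_of_le n (h.trans (le_holds (p := (· < y n)) hc))
    · exact .of_holds inf_le_right fun c hc v hv h =>
        (Le.of_eqv (eqv_ctob (wf k) c (hv.trans inf_le_left) h)).trans
          (treeToName_le c.2 (hn n) hc v)

end

theorem markov_le_preservesLimits : markov H ≤ preservesLimits H := by
  refine le_iInf fun f => le_iInf fun x => ?_
  rw [le_himp_iff, le_himp_iff, le_himp_iff]
  exact le_sSup (eqv_limit_ctob (inf_le_left.trans (inf_le_left.trans inf_le_left))
    (inf_le_left.trans (inf_le_left.trans inf_le_right)) (inf_le_left.trans inf_le_right)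
    inf_le_right)

/-! ### A valuation of names -/

namespace Name

/-- The truth value of `n ≤ a`, for `some n`, or of `ω < a`, for `none`. -/
def val : Name H → Option ℕ → H
  | zero, some 0 => ⊤
  | zero, some (_ + 1) => ⊥
  | zero, none => ⊥
  | succ _, some 0 => ⊤
  | succ a, some (n + 1) => val a (some n)
  | succ a, none => ⨅ n, val a (some n)
  | limit f, t => ⨆ k, val (f k) t
  | mix _ _, some 0 => ⊤
  | mix w b, some (n + 1) => ⨆ i, w i ⊓ val (b i) (some (n + 1))
  | mix w b, none => ⨆ i, w i ⊓ val (b i) none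

theorem val_some_zero : ∀ a : Name H, val a (some 0) = ⊤
  | zero => rfl
  | succ _ => rfl
  | limit f => by simp only [val, val_some_zero, iSup_const]
  | mix _ _ => rfl

theorem le_val_mix {I : Type u} {w : I → H} {b : I → Name H} (i : I) :
    ∀ t : Option ℕ, w i ⊓ val (b i) t ≤ val (mix w b) t
  | some 0 => le_top
  | some (n + 1) => le_iSup (fun i => w i ⊓ val (b i) (some (n + 1))) i
  | none => le_iSup (fun i => w i ⊓ val (b i) none) i

/-- At `some 0` the valuation of a glued name is `⊤` by definition, not a join over the pieces,
hence the separate hypothesis `hz`. -/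
theorem le_val_mix_himp {I : Type u} {w : I → H} {b : I → Name H} {u z : H} {t : Option ℕ}
    (hz : t = some 0 → z = ⊤) (h : ∀ i, u ≤ w i ⇨ val (b i) t ⇨ z) :
    u ≤ val (mix w b) t ⇨ z := by
  have h' : ⨆ i, w i ⊓ val (b i) t ≤ u ⇨ z := iSup_le fun i => by
    rw [le_himp_iff, inf_comm, ← inf_assoc]
    exact le_himp_iff.1 (le_himp_iff.1 (h i))
  match t with
  | some 0 => exact le_top.trans_eq (by rw [hz rfl, himp_top])
  | some (_ + 1) => exact le_himp_iff'.2 (le_himp_iff.1 h')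
  | none => exact le_himp_iff'.2 (le_himp_iff.1 h')

/-- On `u`, the components of a glued name have equal valuations where they overlap. -/
def Coherent (u : H) : Name H → Prop
  | mix w b => ∀ i j t, u ≤ (w i ⊓ w j) ⇨ val (b i) t ⇨ val (b j) t
  | _ => True

theorem Coherent.cover {I : Type u} {u : H} {v : I → H} (h : u ≤ ⨆ i, v i) :
    ∀ {a : Name H}, (∀ i, Coherent (v i) a) → Coherent u a
  | zero, _ | succ _, _ | limit _, _ => trivial
  | mix _ _, h' => fun i j t => h.trans (iSup_le fun k => h' k i j t)

mutual

theorem Wf.coherent {u : H} {a : Name H} : Wf u a → Coherent u a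
  | .cover _ h h' => .cover h fun k => (h' k).coherent
  | .zero | .succ _ | .limit _ _ => trivial
  | .mix _ _ h => fun i j t => le_himp_iff.2 ((h i j).val t).1

/-- Induction on derivations. The finite levels are needed for `succ_mono` at `none`, because `ω < a
+ 1` means that every `n` is `≤ a`. -/
theorem Le.val {u : H} {a b : Name H} : Le u a b → ∀ t, u ≤ val a t ⇨ val b t
  | .cover _ h h', t => h.trans (iSup_le fun k => (h' k).val t)
  | .zero _, some 0 => by simp [val_some_zero]
  | .zero _, some (_ + 1) => by simp [Name.val]
  | .zero _, none => by simp [Name.val]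
  | .trans h h', t => (le_inf (h.val t) (h'.val t)).trans (himp_triangle _ _ _)
  | .succ_mono _, some 0 => by simp [val_some_zero]
  | .succ_mono h, some (n + 1) => h.val (some n)
  | .succ_mono h, none => le_himp_iff.2 (le_iInf fun n =>
      (inf_le_inf_left _ (iInf_le _ n)).trans (le_himp_iff.1 (h.val (some n))))
  | .cocone (f := f) k _ h, t =>
      (h.val t).trans (himp_le_himp_left (le_iSup (fun k => Name.val (f k) t) k))
  | .limiting (f := f) _ h, t => by
      rw [le_himp_iff', Name.val]
      exact iSup_inf_eq _ _ |>.trans_le (iSup_le fun k => le_himp_iff'.1 ((h k).val t))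
  | .of_eqv h, t => (h.val t).1

theorem Eqv.val {u : H} {a b : Name H} :
    Eqv u a b → ∀ t, u ≤ val a t ⇨ val b t ∧ u ≤ val b t ⇨ val a t
  | .cover _ h h', t => ⟨h.trans (iSup_le fun k => ((h' k).val t).1),
      h.trans (iSup_le fun k => ((h' k).val t).2)⟩
  | .refl _, t => by simp
  | .symm h, t => (h.val t).symm
  | .trans h h', t => ⟨(le_inf (h.val t).1 (h'.val t).1).trans (himp_triangle _ _ _),
      (le_inf (h'.val t).2 (h.val t).2).trans (himp_triangle _ _ _)⟩
  | .succ _, some 0 => by simp [val_some_zero]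
  | .succ h, some (n + 1) => h.val (some n)
  | .succ h, none =>
      ⟨le_himp_iff.2 (le_iInf fun n =>
        (inf_le_inf_left _ (iInf_le _ n)).trans (le_himp_iff.1 (h.val (some n)).1)),
      le_himp_iff.2 (le_iInf fun n =>
        (inf_le_inf_left _ (iInf_le _ n)).trans (le_himp_iff.1 (h.val (some n)).2))⟩
  | .limit _ _ h, t => by
      simp only [Name.val, le_himp_iff, inf_iSup_eq, iSup_le_iff]
      exact ⟨fun k => le_iSup_of_le k (le_himp_iff.1 ((h k).val t).1),
        fun k => le_iSup_of_le k (le_himp_iff.1 ((h k).val t).2)⟩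
  | .bisim (f := f) (g := g) p q _ _ hp h hq h', t => by
      simp only [Name.val, iSup_himp_eq, le_iInf_iff]
      exact ⟨fun k => (hp k).trans (iSup_le fun n => ((h k n).val t).trans
          (himp_le_himp_left (le_iSup (fun k => Name.val (g k) t) n))),
        fun k => (hq k).trans (iSup_le fun n => ((h' k n).val t).trans
          (himp_le_himp_left (le_iSup (fun k => Name.val (f k) t) n)))⟩
  | .mix (w := w) (b := b) i h hi, t => by
      -- The valuation joins over all pieces `j`; since `u ≤ w i`, each contribution lies on the
      -- overlap with `i`, where coherence moves it to `b i`.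
      refine ⟨le_val_mix_himp (fun e => e ▸ val_some_zero _) fun j => ?_, ?_⟩
      · have := h.coherent j i t
        rw [le_himp_iff] at this ⊢
        exact (le_inf inf_le_left (le_inf inf_le_right (inf_le_left.trans hi))).trans this
      · exact le_himp_iff.2 ((inf_le_inf_right _ hi).trans (le_val_mix i t))

end

end Name

/-! ### Preservation of limits implies Markov's principle -/

/-- The natural number `n`, or `ω + n`, according to the boolean. -/
def natOrOmegaAdd (n : ℕ) : Bool → CTree
  | false => CTree.powMul .zero n
  | true => .node (.succ .zero) (CTree.powMul .zero n)

/-- `ω · 2`. -/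
def omegaTwo : CTree := .node (.succ .zero) (.node (.succ .zero) .zero)

theorem fund_omegaTwo : omegaTwo.Fund fun n => natOrOmegaAdd n true :=
  .tail _ (.pow_succ _)

theorem isCNF_omegaTwo : omegaTwo.IsCNF :=
  .node (.succ .zero) (.node (.succ .zero) .zero (CTree.zero_le _)) (.refl _)

theorem isCNF_natOrOmegaAdd (n : ℕ) : ∀ b, (natOrOmegaAdd n b).IsCNF
  | false => CTree.isCNF_powMul .zero n
  | true => fund_omegaTwo.isCNF isCNF_omegaTwo n

/-- `ω · 2` as a normal form. -/
def cnfOmegaTwo : Cnf := ⟨omegaTwo, isCNF_omegaTwo⟩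

/-- The normal form `n` or `ω + n`, according to the boolean. -/
def cnfNatOrOmegaAdd (n : ℕ) (b : Bool) : Cnf := ⟨natOrOmegaAdd n b, isCNF_natOrOmegaAdd n b⟩

theorem natOrOmegaAdd_lt_omegaTwo (n : ℕ) : ∀ b, (natOrOmegaAdd n b).Lt omegaTwo
  | false => (CTree.powMul_lt_pow_succ .zero n).trans (.right _ (.zero_node _ _))
  | true => fund_omegaTwo.lt n

/-- The boolean may switch to `true` but never back, which keeps the sequence increasing across the
jump. -/
theorem natOrOmegaAdd_lt_succ (n : ℕ) :
    ∀ b c, b ≤ c → (natOrOmegaAdd n b).Lt (natOrOmegaAdd (n + 1) c)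
  | false, false, _ => CTree.powMul_lt_powMul .zero n
  | false, true, _ => (CTree.powMul_lt_pow_succ .zero n).trans (.right _ (.zero_node _ _))
  | true, true, _ => fund_omegaTwo.incr n

theorem omegaAdd_mono {m n : ℕ} (h : m ≤ n) :
    (natOrOmegaAdd m true).Le (natOrOmegaAdd n true) := by
  induction h with
  | refl => exact .refl _
  | step _ ih => exact .inl (ih.trans_lt (fund_omegaTwo.incr _))

theorem val_nat_self (n : ℕ) : (treeToName H (natOrOmegaAdd n false)).val (some n) = ⊤ := by
  simp only [natOrOmegaAdd, treeToName_powMul]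
  induction n with
  | zero => rfl
  | succ n ih => exact ih

theorem val_nat_succ (n : ℕ) :
    (treeToName H (natOrOmegaAdd n false)).val (some (n + 1)) = ⊥ := by
  simp only [natOrOmegaAdd, treeToName_powMul]
  induction n with
  | zero => rfl
  | succ n ih => exact ih

theorem val_nat_none (n : ℕ) : (treeToName H (natOrOmegaAdd n false)).val none = ⊥ := by
  cases n with
  | zero => rfl
  | succ n =>
    have h := val_nat_succ (H := H) n
    simp only [natOrOmegaAdd, treeToName_powMul] at h ⊢
    exact le_bot_iff.1 ((iInf_le _ (n + 1)).trans_eq h)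

theorem val_omegaTwo : (treeToName H omegaTwo).val none = ⊤ := by
  rw [treeToName_fund H fund_omegaTwo, eq_top_iff, val]
  -- Index 1 gives `ω + 1`, the first term strictly above `ω`.
  refine le_iSup_of_le 1 ?_
  change ⊤ ≤ (treeToName H (CTree.succ (.node (.succ .zero) .zero))).val none
  rw [treeToName_succ, treeToName_fund H (.pow_succ .zero)]
  exact le_iInf fun n => le_iSup_of_le n (val_nat_self n).ge

section

variable {s : ℕ → Bool → H} {u : H}

/-- The truth values of: `s` is `false` below `n`; `s` is `true` somewhere below `n`. -/
def below (s : ℕ → Bool → H) : ℕ → Bool → H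
  | 0, false => ⊤
  | 0, true => ⊥
  | n + 1, false => below s n false ⊓ s n false
  | n + 1, true => below s n true ⊔ s n true

theorem below_true_le (s : ℕ → Bool → H) : ∀ n, below s n true ≤ ⨆ k, s k true
  | 0 => bot_le
  | n + 1 => sup_le (below_true_le s n) (le_iSup (fun k => s k true) n)

theorem below_true_mono {m n : ℕ} (h : m ≤ n) : below s m true ≤ below s n true := by
  induction h with
  | refl => exact le_rfl
  | step _ ih => exact ih.trans le_sup_left

theorem isFun_le_isFun_below (s : ℕ → Bool → H) : isFun s ≤ isFun (below s) := by
  have hs := le_isFun_iff.1 (le_refl (isFun s))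
  simp only [iSup_bool_eq] at hs
  have total (n) : isFun s ≤ below s n true ⊔ below s n false := by
    induction n with
    | zero => exact le_top.trans le_sup_right
    | succ n ih =>
      refine le_of_le_sup ih (fun v _ h => (h.trans le_sup_left).trans le_sup_left) fun v hv h => ?_
      refine le_of_le_sup (hv.trans (hs n).1) (fun v _ h => (h.trans le_sup_right).trans le_sup_left)
        fun v hv' h' => (le_inf (hv'.trans h) h').trans le_sup_right
  have disjoint (n) : isFun s ⊓ (below s n true ⊓ below s n false) ≤ ⊥ := by
    induction n with
    | zero => exact inf_le_right.trans inf_le_left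
    | succ n ih =>
      refine le_of_le_sup (inf_le_right.trans inf_le_left) (fun v hv h => ?_) fun v hv h => ?_
      · exact (le_inf (hv.trans inf_le_left) (le_inf h (hv.trans (inf_le_right.trans
          (inf_le_right.trans inf_le_left))))).trans ih
      · exact (le_inf (hv.trans inf_le_left) (le_inf h (hv.trans (inf_le_right.trans
          (inf_le_right.trans inf_le_right))))).trans ((hs n).2 true false nofun)
  refine le_isFun_iff.2 fun n => ⟨by simpa only [iSup_bool_eq] using total n, ?_⟩
  rintro (_ | _) (_ | _) h
  · exact absurd rfl h
  · rw [inf_comm (below s n false)]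
    exact disjoint n
  · exact disjoint n
  · exact absurd rfl h

/-- `n` if `s` is `false` below `n`, and `ω + n` otherwise. -/
def markovSeq (s : ℕ → Bool → H) (n : ℕ) (c : Cnf) : H :=
  holds (below s n) fun b => cnfNatOrOmegaAdd n b = c

theorem below_le_markovSeq (s : ℕ → Bool → H) (n : ℕ) (b : Bool) :
    below s n b ≤ markovSeq s n (cnfNatOrOmegaAdd n b) :=
  le_holds (p := fun b' => cnfNatOrOmegaAdd n b' = _) rfl

theorem le_cnfIncr_markovSeq (hs : u ≤ isFun s) : u ≤ cnfIncr (markovSeq s) := by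
  have hb := le_isFun_iff.1 (hs.trans (isFun_le_isFun_below s))
  have hs := le_isFun_iff.1 hs
  refine le_iInf fun n => ?_
  have key (b c : Bool) (h : b ≤ c) {v : H} (hb : v ≤ below s n b) (hc : v ≤ below s (n + 1) c) :=
    le_iSup_of_le (f := fun a => ⨆ d, ⨆ _ : a < d, markovSeq s n a ⊓ markovSeq s (n + 1) d)
      (cnfNatOrOmegaAdd n b)
      (le_iSup₂_of_le (cnfNatOrOmegaAdd (n + 1) c)
        (natOrOmegaAdd_lt_succ n b c h) (le_inf (hb.trans (below_le_markovSeq s n b))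
          (hc.trans (below_le_markovSeq s (n + 1) c))))
  refine le_of_cover (hb n).1 fun b v hv h => ?_
  cases b with
  | true => exact key true true le_rfl h (h.trans le_sup_left)
  | false =>
    refine le_of_cover (hv.trans (hs n).1) fun b v hv' h' => ?_
    cases b with
    | true => exact key false true (Bool.false_le _) (hv'.trans h) (h'.trans le_sup_right)
    | false => exact key false false le_rfl (hv'.trans h) (le_inf (hv'.trans h) h')

theorem le_cnfIsLimitOf_markovSeq (hs : u ≤ isFun s) (hn : u ≤ (⨅ n, s n false)ᶜ) :
    u ≤ cnfIsLimitOf cnfOmegaTwo (markovSeq s) := by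
  have hb := le_isFun_iff.1 (hs.trans (isFun_le_isFun_below s))
  have hs := le_isFun_iff.1 hs
  refine le_inf (le_cnfBound fun n => le_of_cover (hb n).1 fun b v _ h => ?_)
    (le_iInf fun c => le_himp_iff.2 ?_)
  · exact (h.trans (below_le_markovSeq s n b)).trans
      (le_holds (p := (· ≤ cnfOmegaTwo))
        (.inl (natOrOmegaAdd_lt_omegaTwo n b)))
  by_cases hc : cnfOmegaTwo ≤ c
  · exact le_iSup_of_le hc le_top
  obtain ⟨N, hN⟩ := fund_omegaTwo.exists_lt c.2 (CTree.not_le.1 hc)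
  -- A bound `c < ω + N` excludes any jump, so `s` would be constantly false.
  suffices u ⊓ cnfBound (markovSeq s) c ≤ ⨅ n, s n false from
    ((le_inf (inf_le_left.trans hn) this).trans (compl_inf_self _).le).trans bot_le
  refine le_iInf fun n => le_of_cover (inf_le_left.trans (hs n).1) fun b v hv h => ?_
  cases b with
  | false => exact h
  | true =>
    have hv₁ := hv.trans inf_le_left
    -- Index at least `n + 1` to have seen `s n`, and at least `N` for the term to exceed `c`.
    have ht : v ≤ below s (max N (n + 1)) true :=
      (h.trans le_sup_right).trans (below_true_mono (m := n + 1) (le_max_right N _))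
    refine le_of_holds (hv.trans (inf_le_right.trans (iInf_le _ (max N (n + 1)))))
      fun a ha v hv h => le_of_holds h fun b e v hv' h => ?_
    have hv := hv'.trans hv
    cases b with
    | true =>
      refine absurd ?_ (CTree.not_le.2 (hN.trans_le (omegaAdd_mono (le_max_left N (n + 1)))))
      rw [← e] at ha
      exact ha
    | false =>
      exact ((le_inf (hv.trans hv₁) (le_inf (hv.trans ht) h)).trans
        ((hb _).2 true false nofun)).trans bot_le

theorem val_ctob_markovSeq_le (n : ℕ) : (ctob (markovSeq s n)).val none ≤ ⨆ n, s n true := by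
  refine iSup_le fun ⟨c⟩ => le_of_holds inf_le_left fun b e v hv h => ?_
  cases b with
  | true => exact h.trans (below_true_le s n)
  | false =>
    subst e
    exact hv.trans (inf_le_right.trans ((val_nat_none n).trans_le bot_le))

end

/-- Wherever `ω · 2` equals the limit, the valuation at `none` passes from `⊤` to the join of its
values at the terms, each of which forces `s` to be true somewhere. -/
theorem preservesLimits_le_markov : preservesLimits H ≤ markov H := by
  refine le_iInf fun s => ?_
  rw [le_himp_iff, le_himp_iff]
  have hs : preservesLimits H ⊓ isFun s ⊓ (⨅ n, s n false)ᶜ ≤ isFun s :=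
    inf_le_left.trans inf_le_right
  have h := le_himp_iff.1 (le_himp_iff.1 (le_himp_iff.1
    ((iInf_le _ (markovSeq s)).trans (iInf_le _ cnfOmegaTwo) :
      preservesLimits H ≤ _)))
  refine (le_inf (le_inf (le_inf (inf_le_left.trans inf_le_left) (hs.trans
    ((isFun_le_isFun_below s).trans (isFun_le_isFun_map _ _)))) (le_cnfIncr_markovSeq hs))
    (le_cnfIsLimitOf_markovSeq hs inf_le_right)).trans (h.trans (sSup_le fun v hv => ?_))
  have hv : v ≤ (treeToName H omegaTwo).val none ⇨ _ := (Eqv.val hv none).1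
  rw [val_omegaTwo, top_himp] at hv
  exact hv.trans (iSup_le val_ctob_markovSeq_le)

end Heyting

theorem theorem69 :
    (CtoBPreservesLimits ↔ MarkovPrinciple) ∧
    ∀ (H : Type*) [Order.Frame H], Heyting.preservesLimits H = Heyting.markov H :=
  ⟨⟨fun _ => markovPrinciple, .of_markov⟩, fun _ _ =>
    le_antisymm Heyting.preservesLimits_le_markov Heyting.markov_le_preservesLimits⟩
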